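/- Let $k$ be a field and let $H$ be a Hopf algebra over $k$ with antipode $S : H \to H$. Let $H_0$ be the coradical of $H$, that is, the sum of all simple subcoalgebras of $H$, where a simple subcoalgebra is a nonzero subcoalgebra whose only subcoalgebras are $0$ and itself. If $H_0 \subseteq S(H)$, then $S$ is surjective. -/

import Mathlib

open scoped TensorProduct

/-- A linear subspace `D` of a `k`-coalgebra `C` is a subcoalgebra if `Δ(D) ⊆ D ⊗ D`, where
`D ⊗ D` is identified with its image in `C ⊗ C`. -/
def IsSubcoalgebra (k : Type*) {C : Type*} [Field k] [AddCommGroup C] [Module k C]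
    [Coalgebra k C] (D : Submodule k C) : Prop :=
  ∀ x ∈ D, Coalgebra.comul (R := k) x ∈ LinearMap.range (TensorProduct.mapIncl D D)

/-- A simple subcoalgebra: a nonzero subcoalgebra whose only subcoalgebras are zero and
itself. -/
structure IsSimpleSubcoalgebra (k : Type*) {C : Type*} [Field k] [AddCommGroup C] [Module k C]
    [Coalgebra k C] (D : Submodule k C) : Prop where
  isSubcoalgebra : IsSubcoalgebra k D
  ne_bot : D ≠ ⊥
  eq_bot_or_eq : ∀ E : Submodule k C, IsSubcoalgebra k E → E ≤ D → E = ⊥ ∨ E = D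

/-- The coradical `C₀` of a coalgebra `C`: the sum of all its simple subcoalgebras. -/
def coradical (k C : Type*) [Field k] [AddCommGroup C] [Module k C] [Coalgebra k C] :
    Submodule k C :=
  sSup {D : Submodule k C | IsSimpleSubcoalgebra k D}

/-! The image `B` of `S` is a subcoalgebra closed under products, because `S` reverses both
structures. It absorbs wedges (`HopfAlgebra.mem_of_comul_mem_sup`): let `p` be a projection onto
`B`; for `Δ x ∈ B ⊗ H + H ⊗ B`, computing `x₁ S(x₂) p(x₃)` modulo `B` gives `x` with one bracketing
and `0` with the other. A subcoalgebra that contains the coradical and absorbs wedges is everything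
(`IsSubcoalgebra.eq_top_of_coradical_le`). Put `x` in a finite-dimensional subcoalgebra `D` and work
in the dual algebra modulo `D^⊥`, an Artinian ring. If a power of `B^⊥` lies in `D^⊥`, then `D` is
contained in an iterated wedge of `B`, hence in `B`. Otherwise `B^⊥` is comaximal with a proper
two-sided ideal containing `D^⊥`, whose common zeros contain a simple subcoalgebra meeting `B` only
in `0`, which is impossible. -/

/-! ### Two-sided ideals in Artinian rings -/

/-- In an Artinian ring, a two-sided ideal is either nilpotent or comaximal with a proper two-sided
ideal. -/
theorem IsArtinianRing.isNilpotent_or_exists_sup_eq_top {R : Type*} [Ring R] [IsArtinianRing R]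
    (I : Ideal R) [I.IsTwoSided] :
    IsNilpotent I ∨ ∃ K : Ideal R, K.IsTwoSided ∧ K ≠ ⊤ ∧ I ⊔ K = ⊤ := by
  let K : Ideal R :=
    { carrier := {a | ∀ i ∈ I, i * a ∈ Ring.jacobson R}
      add_mem' := fun {a b} ha hb i hi => by
        rw [mul_add]; exact add_mem (ha i hi) (hb i hi)
      zero_mem' := fun i _ => by simp
      smul_mem' := fun r a ha i hi => by
        rw [smul_eq_mul, ← mul_assoc]; exact ha _ (I.mul_mem_right r hi) }
  have hK : K.IsTwoSided := ⟨fun {a} b ha i hi => by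
    rw [← mul_assoc]; exact Ideal.mul_mem_right b _ (ha i hi)⟩
  by_cases htop : K = ⊤
  · left
    have hI : I ≤ Ring.jacobson R := fun i hi => by
      have h1 : (1 : R) ∈ K := htop ▸ Submodule.mem_top
      simpa using h1 i hi
    obtain ⟨n, hn⟩ := IsSemiprimaryRing.isNilpotent (R := R)
    exact ⟨n, le_bot_iff.mp ((Ideal.pow_right_mono hI n).trans hn.le)⟩
  · right
    refine ⟨K, hK, htop, ?_⟩
    let J := Ring.jacobson R
    have hsurj : Function.Surjective (Ideal.Quotient.mk J) := Ideal.Quotient.mk_surjective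
    -- `R ⧸ J` is semisimple, so a complementary left ideal `L` exists. The image of `I` times `L`
    -- lies in their intersection, so representatives of `L` belong to `K`.
    obtain ⟨L, hL⟩ := exists_isCompl (I.map (Ideal.Quotient.mk J))
    have h1 : (1 : R ⧸ J) ∈ I.map (Ideal.Quotient.mk J) ⊔ L :=
      hL.sup_eq_top ▸ Submodule.mem_top
    obtain ⟨u, hu, l, hl, hul⟩ := Submodule.mem_sup.mp h1
    obtain ⟨i, hi, rfl⟩ := (Ideal.mem_map_iff_of_surjective _ hsurj).mp hu
    obtain ⟨a, rfl⟩ := hsurj l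
    have ha : a ∈ K := fun j hj => by
      rw [← Ideal.Quotient.eq_zero_iff_mem]
      refine (Submodule.mem_bot (R ⧸ J)).mp (hL.inf_eq_bot ▸ Submodule.mem_inf.mpr ⟨?_, ?_⟩)
      · exact Ideal.mem_map_of_mem _ (I.mul_mem_right a hj)
      · rw [map_mul]; exact L.mul_mem_left _ hl
    have hJK : J ≤ K := fun b hb j _ => Ideal.mul_mem_left _ j hb
    have hr : 1 - (i + a) ∈ J := by
      rw [← Ideal.Quotient.eq_zero_iff_mem, map_sub, map_add, hul, map_one, sub_self]
    rw [Ideal.eq_top_iff_one]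
    have : (1 : R) = i + (a + (1 - (i + a))) := by abel
    rw [this]
    exact Submodule.add_mem_sup hi (add_mem ha (hJK hr))

theorem exists_pow_le_or_exists_sup_eq_top {R : Type*} [Ring R] (N : Ideal R) [N.IsTwoSided]
    [IsArtinianRing (R ⧸ N)] (I : Ideal R) [I.IsTwoSided] :
    (∃ n, I ^ n ≤ N) ∨ ∃ K : Ideal R, K.IsTwoSided ∧ N ≤ K ∧ K ≠ ⊤ ∧ I ⊔ K = ⊤ := by
  have hsurj : Function.Surjective (Ideal.Quotient.mk N) := Ideal.Quotient.mk_surjective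
  have : (I.map (Ideal.Quotient.mk N)).IsTwoSided := ⟨fun {a} b ha => by
    obtain ⟨i, hi, rfl⟩ := (Ideal.mem_map_iff_of_surjective _ hsurj).mp ha
    obtain ⟨b, rfl⟩ := hsurj b
    rw [← map_mul]; exact Ideal.mem_map_of_mem _ (I.mul_mem_right b hi)⟩
  rcases IsArtinianRing.isNilpotent_or_exists_sup_eq_top (I.map (Ideal.Quotient.mk N)) with
    ⟨n, hn⟩ | ⟨K, hK, htop, hsup⟩
  · refine Or.inl ⟨n, ?_⟩
    have key : ∀ m, ∀ x ∈ I ^ m, Ideal.Quotient.mk N x ∈ (I.map (Ideal.Quotient.mk N)) ^ m := by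
      intro m
      induction m with
      | zero => intro x _; simp [Submodule.pow_zero, Ideal.one_eq_top]
      | succ m ih =>
        intro x hx
        rw [Submodule.pow_succ] at hx ⊢
        refine Submodule.smul_induction_on hx (fun a ha b hb => ?_) (fun a b ha hb => ?_)
        · rw [smul_eq_mul, map_mul]
          exact Ideal.mul_mem_mul (ih a ha) (Ideal.mem_map_of_mem _ hb)
        · rw [map_add]; exact add_mem ha hb
    intro x hx
    rw [← Ideal.Quotient.eq_zero_iff_mem]
    simpa [hn] using key n x hx
  · refine Or.inr ⟨K.comap (Ideal.Quotient.mk N), ⟨fun {a} b ha => ?_⟩, fun x hx => ?_, ?_, ?_⟩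
    · rw [Ideal.mem_comap, map_mul]; exact K.mul_mem_right _ ha
    · rw [Ideal.mem_comap, Ideal.Quotient.eq_zero_iff_mem.mpr hx]; exact zero_mem _
    · intro h
      exact htop (by rw [Ideal.eq_top_iff_one] at h ⊢; simpa using h)
    · have h1 : (1 : R ⧸ N) ∈ I.map (Ideal.Quotient.mk N) ⊔ K := hsup ▸ Submodule.mem_top
      obtain ⟨u, hu, l, hl, hul⟩ := Submodule.mem_sup.mp h1
      obtain ⟨i, hi, rfl⟩ := (Ideal.mem_map_iff_of_surjective _ hsurj).mp hu
      rw [Ideal.eq_top_iff_one]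
      have : (1 : R) = i + (1 - i) := by abel
      rw [this]
      refine Submodule.add_mem_sup hi ?_
      rw [Ideal.mem_comap, map_sub, map_one, ← hul, add_sub_cancel_left]
      exact hl

open Coalgebra LinearMap WithConv

/-! ### Detecting subspaces of tensor products by pairs of functionals -/

section TensorSeparation

variable {k V W : Type*} [Field k] [AddCommGroup V] [Module k V] [AddCommGroup W] [Module k W]

theorem TensorProduct.eq_zero_of_forall_dual {t : V ⊗[k] W}
    (h : ∀ (f : V →ₗ[k] k) (g : W →ₗ[k] k), mul' k k (TensorProduct.map f g t) = 0) : t = 0 := by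
  let b := Module.Basis.ofVectorSpace k V
  let c := Module.Basis.ofVectorSpace k W
  refine (b.tensorProduct c).ext_elem fun ⟨i, j⟩ => ?_
  have key : (b.tensorProduct c).coord (i, j) =
      mul' k k ∘ₗ TensorProduct.map (b.coord i) (c.coord j) := by
    ext v w
    simp [Module.Basis.tensorProduct_repr_tmul_apply, mul_comm]
  have := LinearMap.congr_fun key t
  simpa [h] using this

theorem Submodule.exists_projection (B : Submodule k V) :
    ∃ p : V →ₗ[k] V, (∀ v, p v ∈ B) ∧ ∀ v ∈ B, p v = v := by
  obtain ⟨r, hr⟩ := B.subtype.exists_leftInverse_of_injective B.ker_subtype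
  exact ⟨B.subtype ∘ₗ r, fun v => (r v).2,
    fun v hv => congrArg Subtype.val (LinearMap.congr_fun hr ⟨v, hv⟩)⟩

theorem TensorProduct.mem_range_rTensor_sup_range_lTensor {B : Submodule k V} {C : Submodule k W}
    {t : V ⊗[k] W}
    (h : ∀ (f : V →ₗ[k] k) (g : W →ₗ[k] k), (∀ x ∈ B, f x = 0) → (∀ x ∈ C, g x = 0) →
      mul' k k (TensorProduct.map f g t) = 0) :
    t ∈ range (B.subtype.rTensor W) ⊔ range (C.subtype.lTensor V) := by
  obtain ⟨p, hp, hpB⟩ := B.exists_projection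
  obtain ⟨q, hq, hqC⟩ := C.exists_projection
  have h0 : TensorProduct.map (.id - p) (.id - q) t = 0 := by
    refine TensorProduct.eq_zero_of_forall_dual fun f g => ?_
    rw [← LinearMap.comp_apply (TensorProduct.map f g), ← TensorProduct.map_comp]
    exact h _ _ (fun x hx => by simp [hpB x hx]) (fun x hx => by simp [hqC x hx])
  -- Based on `1 ⊗ 1 - (1 - p) ⊗ (1 - q) = p ⊗ 1 + (1 - p) ⊗ q`.
  have key : ∀ t : V ⊗[k] W, t - TensorProduct.map (.id - p) (.id - q) t ∈
      range (B.subtype.rTensor W) ⊔ range (C.subtype.lTensor V) := by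
    intro t
    induction t with
    | zero => simp
    | add t₁ t₂ h₁ h₂ => rw [map_add, add_sub_add_comm]; exact add_mem h₁ h₂
    | tmul v w =>
      have : v ⊗ₜ[k] w - TensorProduct.map (.id - p) (.id - q) (v ⊗ₜ w) =
          p v ⊗ₜ w + (v - p v) ⊗ₜ q w := by
        simp only [LinearMap.id_apply, TensorProduct.map_tmul, LinearMap.sub_apply,
          TensorProduct.sub_tmul, TensorProduct.tmul_sub]
        abel
      rw [this]
      exact Submodule.add_mem_sup ⟨⟨p v, hp v⟩ ⊗ₜ w, by simp⟩ ⟨(v - p v) ⊗ₜ ⟨q w, hq w⟩, by simp⟩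
  simpa [h0] using key t

theorem TensorProduct.mem_range_mapIncl {B : Submodule k V} {C : Submodule k W} {t : V ⊗[k] W}
    (h₁ : ∀ (f : V →ₗ[k] k) (g : W →ₗ[k] k), (∀ x ∈ B, f x = 0) →
      mul' k k (TensorProduct.map f g t) = 0)
    (h₂ : ∀ (f : V →ₗ[k] k) (g : W →ₗ[k] k), (∀ x ∈ C, g x = 0) →
      mul' k k (TensorProduct.map f g t) = 0) :
    t ∈ range (TensorProduct.mapIncl B C) := by
  obtain ⟨p, hp, hpB⟩ := B.exists_projection
  obtain ⟨q, hq, hqC⟩ := C.exists_projection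
  have e₁ : TensorProduct.map (.id - p) .id t = 0 := by
    refine TensorProduct.eq_zero_of_forall_dual fun f g => ?_
    rw [← LinearMap.comp_apply (TensorProduct.map f g), ← TensorProduct.map_comp]
    exact h₁ _ _ (fun x hx => by simp [hpB x hx])
  have e₂ : TensorProduct.map p (.id - q) t = 0 := by
    refine TensorProduct.eq_zero_of_forall_dual fun f g => ?_
    rw [← LinearMap.comp_apply (TensorProduct.map f g), ← TensorProduct.map_comp]
    exact h₂ _ _ (fun x hx => by simp [hqC x hx])
  have key : ∀ t : V ⊗[k] W, t - TensorProduct.map (.id - p) .id t -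
      TensorProduct.map p (.id - q) t ∈ range (TensorProduct.mapIncl B C) := by
    intro t
    induction t with
    | zero => simp
    | add t₁ t₂ h₁ h₂ =>
      rw [map_add, map_add, add_sub_add_comm, add_sub_add_comm]; exact add_mem h₁ h₂
    | tmul v w =>
      refine ⟨⟨p v, hp v⟩ ⊗ₜ ⟨q w, hq w⟩, ?_⟩
      simp [TensorProduct.sub_tmul, TensorProduct.tmul_sub, TensorProduct.mapIncl]
  simpa [e₁, e₂] using key t

end TensorSeparation

/-! ### Actions of the dual algebra and the fundamental theorem of coalgebras -/

section DualAction

variable {k C : Type*} [Field k] [AddCommGroup C] [Module k C] [Coalgebra k C]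

/-- The left action `f ⇀ x = x₁ f(x₂)` of the dual algebra of a coalgebra. -/
noncomputable def Coalgebra.hitLeft (f : WithConv (C →ₗ[k] k)) : C →ₗ[k] C :=
  (_root_.TensorProduct.rid k C).toLinearMap ∘ₗ f.ofConv.lTensor C ∘ₗ comul

/-- The right action `x ↼ f = f(x₁) x₂` of the dual algebra of a coalgebra. -/
noncomputable def Coalgebra.hitRight (f : WithConv (C →ₗ[k] k)) : C →ₗ[k] C :=
  (_root_.TensorProduct.lid k C).toLinearMap ∘ₗ f.ofConv.rTensor C ∘ₗ comul

theorem Coalgebra.apply_hitLeft (f g : WithConv (C →ₗ[k] k)) (x : C) :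
    f (hitLeft g x) = (f * g) x := by
  have : f.ofConv ∘ₗ (_root_.TensorProduct.rid k C).toLinearMap ∘ₗ g.ofConv.lTensor C =
      mul' k k ∘ₗ _root_.TensorProduct.map f.ofConv g.ofConv := by ext; simp [mul_comm]
  exact LinearMap.congr_fun this (comul x)

theorem Coalgebra.apply_hitRight (f g : WithConv (C →ₗ[k] k)) (x : C) :
    f (hitRight g x) = (g * f) x := by
  have : f.ofConv ∘ₗ (_root_.TensorProduct.lid k C).toLinearMap ∘ₗ g.ofConv.rTensor C =
      mul' k k ∘ₗ _root_.TensorProduct.map g.ofConv f.ofConv := by ext; simp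
  exact LinearMap.congr_fun this (comul x)

theorem Module.eq_of_forall_withConv_dual {k V : Type*} [Field k] [AddCommGroup V] [Module k V]
    {x y : V} (h : ∀ f : WithConv (V →ₗ[k] k), f x = f y) : x = y := by
  rw [← sub_eq_zero, ← Module.forall_dual_apply_eq_zero_iff k]
  intro f
  rw [map_sub, sub_eq_zero]
  exact h (toConv f)

theorem Coalgebra.hitLeft_hitLeft (f g : WithConv (C →ₗ[k] k)) (x : C) :
    hitLeft f (hitLeft g x) = hitLeft (f * g) x :=
  Module.eq_of_forall_withConv_dual fun φ => by
    rw [apply_hitLeft, apply_hitLeft, apply_hitLeft, mul_assoc]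

theorem Coalgebra.hitRight_hitRight (f g : WithConv (C →ₗ[k] k)) (x : C) :
    hitRight f (hitRight g x) = hitRight (g * f) x :=
  Module.eq_of_forall_withConv_dual fun φ => by
    rw [apply_hitRight, apply_hitRight, apply_hitRight, mul_assoc]

theorem Coalgebra.hitRight_hitLeft (f g : WithConv (C →ₗ[k] k)) (x : C) :
    hitRight f (hitLeft g x) = hitLeft g (hitRight f x) :=
  Module.eq_of_forall_withConv_dual fun φ => by
    rw [apply_hitRight, apply_hitLeft, apply_hitLeft, apply_hitRight, mul_assoc]

theorem Coalgebra.hitLeft_one (x : C) : hitLeft (1 : WithConv (C →ₗ[k] k)) x = x :=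
  Module.eq_of_forall_withConv_dual fun φ => by rw [apply_hitLeft, mul_one]

theorem Coalgebra.hitRight_one (x : C) : hitRight (1 : WithConv (C →ₗ[k] k)) x = x :=
  Module.eq_of_forall_withConv_dual fun φ => by rw [apply_hitRight, one_mul]

theorem Coalgebra.exists_finite_hitLeft_mem (x : C) :
    ∃ s : Finset C, ∀ f : WithConv (C →ₗ[k] k), hitLeft f x ∈ Submodule.span k (s : Set C) := by
  classical
  refine ⟨(ℛ k x).index.image (ℛ k x).left, fun f => ?_⟩
  rw [hitLeft, comp_apply, comp_apply, ← (ℛ k x).eq, map_sum, map_sum]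
  refine Submodule.sum_mem _ fun i hi => ?_
  simpa using Submodule.smul_mem _ _
    (Submodule.subset_span (Finset.mem_coe.mpr (Finset.mem_image.mpr ⟨i, hi, rfl⟩)))

theorem Coalgebra.exists_finite_hitRight_mem (x : C) :
    ∃ s : Finset C, ∀ f : WithConv (C →ₗ[k] k), hitRight f x ∈ Submodule.span k (s : Set C) := by
  classical
  refine ⟨(ℛ k x).index.image (ℛ k x).right, fun f => ?_⟩
  rw [hitRight, comp_apply, comp_apply, ← (ℛ k x).eq, map_sum, map_sum]
  refine Submodule.sum_mem _ fun i hi => ?_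
  simpa using Submodule.smul_mem _ _
    (Submodule.subset_span (Finset.mem_coe.mpr (Finset.mem_image.mpr ⟨i, hi, rfl⟩)))

theorem IsSubcoalgebra.hitLeft_mem {D : Submodule k C} (hD : IsSubcoalgebra k D)
    (f : WithConv (C →ₗ[k] k)) {x : C} (hx : x ∈ D) : hitLeft f x ∈ D := by
  obtain ⟨t, ht⟩ := hD x hx
  rw [hitLeft, comp_apply, comp_apply, ← ht]
  clear ht
  induction t with
  | zero => simp
  | add t₁ t₂ h₁ h₂ => rw [map_add, map_add, map_add]; exact add_mem h₁ h₂
  | tmul a b => simpa [TensorProduct.mapIncl] using D.smul_mem _ a.2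

theorem IsSubcoalgebra.hitRight_mem {D : Submodule k C} (hD : IsSubcoalgebra k D)
    (f : WithConv (C →ₗ[k] k)) {x : C} (hx : x ∈ D) : hitRight f x ∈ D := by
  obtain ⟨t, ht⟩ := hD x hx
  rw [hitRight, comp_apply, comp_apply, ← ht]
  clear ht
  induction t with
  | zero => simp
  | add t₁ t₂ h₁ h₂ => rw [map_add, map_add, map_add]; exact add_mem h₁ h₂
  | tmul a b => simpa [TensorProduct.mapIncl] using D.smul_mem _ b.2

/-- Stability under the two actions makes `f ⊗ g` kill `Δ x` as soon as `f` or `g` vanishes on `D`,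
and such pairs detect `D ⊗ D`. -/
theorem IsSubcoalgebra.of_hit_mem {D : Submodule k C}
    (hl : ∀ (f : WithConv (C →ₗ[k] k)), ∀ x ∈ D, hitLeft f x ∈ D)
    (hr : ∀ (f : WithConv (C →ₗ[k] k)), ∀ x ∈ D, hitRight f x ∈ D) : IsSubcoalgebra k D := by
  intro x hx
  refine TensorProduct.mem_range_mapIncl (fun f g hf => ?_) (fun f g hg => ?_)
  · exact (apply_hitLeft (toConv f) (toConv g) x).symm.trans (hf _ (hl _ x hx))
  · exact (apply_hitRight (toConv g) (toConv f) x).symm.trans (hg _ (hr _ x hx))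

/-- The fundamental theorem of coalgebras. -/
theorem Coalgebra.exists_finiteDimensional_isSubcoalgebra (x : C) :
    ∃ D : Submodule k C, IsSubcoalgebra k D ∧ FiniteDimensional k D ∧ x ∈ D := by
  classical
  let T : Set C := {y | ∃ f g : WithConv (C →ₗ[k] k), y = hitLeft f (hitRight g x)}
  have hT : ∀ (f g : WithConv (C →ₗ[k] k)), hitLeft f (hitRight g x) ∈ Submodule.span k T :=
    fun f g => Submodule.subset_span ⟨f, g, rfl⟩
  refine ⟨Submodule.span k T, IsSubcoalgebra.of_hit_mem (fun h y hy => ?_) (fun h y hy => ?_),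
    ?_, ?_⟩
  · refine (Submodule.span_le (p := (Submodule.span k T).comap (hitLeft h))).mpr ?_ hy
    rintro _ ⟨f, g, rfl⟩
    simpa [hitLeft_hitLeft] using hT (h * f) g
  · refine (Submodule.span_le (p := (Submodule.span k T).comap (hitRight h))).mpr ?_ hy
    rintro _ ⟨f, g, rfl⟩
    simpa [hitRight_hitLeft, hitRight_hitRight] using hT f (g * h)
  · obtain ⟨s, hs⟩ := exists_finite_hitRight_mem (k := k) x
    choose u hu using fun y : C => exists_finite_hitLeft_mem (k := k) y
    have hle : Submodule.span k T ≤ Submodule.span k ((s.biUnion u : Finset C) : Set C) := by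
      rw [Submodule.span_le]
      rintro _ ⟨f, g, rfl⟩
      refine (Submodule.span_le (p := (Submodule.span k
        ((s.biUnion u : Finset C) : Set C)).comap (hitLeft f))).mpr (fun y hy => ?_) (hs g)
      refine Submodule.span_mono ?_ (hu y f)
      exact_mod_cast Finset.subset_biUnion_of_mem u hy
    exact Submodule.finiteDimensional_of_le hle
  · simpa [hitLeft_one, hitRight_one] using hT 1 1

/-! ### Subcoalgebras versus ideals of the dual algebra; the coradical -/

/-- The ideal of functionals vanishing on a subcoalgebra, in the dual algebra. -/
def IsSubcoalgebra.annihilator {D : Submodule k C} (hD : IsSubcoalgebra k D) :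
    Ideal (WithConv (C →ₗ[k] k)) where
  carrier := {f | ∀ x ∈ D, f x = 0}
  add_mem' {f g} hf hg x hx := by
    change f x + g x = 0
    rw [hf x hx, hg x hx, add_zero]
  zero_mem' x _ := rfl
  smul_mem' g f hf x hx := by
    rw [smul_eq_mul, ← apply_hitRight]
    exact hf _ (hD.hitRight_mem g hx)

theorem IsSubcoalgebra.mem_annihilator {D : Submodule k C} (hD : IsSubcoalgebra k D)
    {f : WithConv (C →ₗ[k] k)} : f ∈ hD.annihilator ↔ ∀ x ∈ D, f x = 0 := Iff.rfl

instance IsSubcoalgebra.annihilator_isTwoSided {D : Submodule k C} (hD : IsSubcoalgebra k D) :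
    hD.annihilator.IsTwoSided where
  mul_mem_of_left {f} g hf x hx := by
    rw [← apply_hitLeft]
    exact hf _ (hD.hitLeft_mem g hx)

theorem IsSubcoalgebra.isArtinianRing_quotient_annihilator {D : Submodule k C}
    [FiniteDimensional k D] (hD : IsSubcoalgebra k D) :
    IsArtinianRing (WithConv (C →ₗ[k] k) ⧸ hD.annihilator) := by
  obtain ⟨r, hr⟩ := D.subtype.exists_leftInverse_of_injective D.ker_subtype
  let e : Module.Dual k D →ₗ[k] WithConv (C →ₗ[k] k) ⧸ hD.annihilator :=
    { toFun := fun φ => Ideal.Quotient.mk _ (toConv (φ ∘ₗ r))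
      map_add' := fun φ ψ => by rw [← map_add]; rfl
      map_smul' := fun c φ => by rfl }
  have he : Function.Surjective e := by
    intro y
    obtain ⟨f, rfl⟩ := Ideal.Quotient.mk_surjective y
    refine ⟨f.ofConv ∘ₗ D.subtype, ?_⟩
    refine Ideal.Quotient.eq.mpr fun x hx => ?_
    have : (r x : C) = x := congrArg Subtype.val (LinearMap.congr_fun hr ⟨x, hx⟩)
    change f (r x : C) - f x = 0
    rw [this, sub_self]
  have : Module.Finite k (WithConv (C →ₗ[k] k) ⧸ hD.annihilator) := Module.Finite.of_surjective e he
  exact IsArtinianRing.of_finite k _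

/-- The common zeros of a set of functionals. -/
def Ideal.coannihilator (K : Ideal (WithConv (C →ₗ[k] k))) : Submodule k C where
  carrier := {x | ∀ f ∈ K, f x = 0}
  add_mem' {x y} hx hy f hf := by rw [map_add, hx f hf, hy f hf, add_zero]
  zero_mem' f _ := map_zero _
  smul_mem' c x hx f hf := by rw [map_smul, hx f hf, smul_zero]

theorem Ideal.isSubcoalgebra_coannihilator (K : Ideal (WithConv (C →ₗ[k] k))) [K.IsTwoSided] :
    IsSubcoalgebra k K.coannihilator :=
  IsSubcoalgebra.of_hit_mem
    (fun f x hx g hg => (apply_hitLeft g f x).trans (hx _ (K.mul_mem_right f hg)))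
    (fun f x hx g hg => (apply_hitRight g f x).trans (hx _ (K.mul_mem_left f hg)))

theorem IsSubcoalgebra.coannihilator_le {D : Submodule k C} (hD : IsSubcoalgebra k D)
    {K : Ideal (WithConv (C →ₗ[k] k))} (hK : hD.annihilator ≤ K) : K.coannihilator ≤ D := by
  intro x hx
  by_contra hxD
  obtain ⟨f, hfx, hf⟩ := Submodule.exists_le_ker_of_notMem hxD
  exact hfx (hx (toConv f) (hK fun y hy => hf hy))

/-- By finite-dimensional duality on `D`, without common zeros the restrictions of `K` would fill
the dual of `D`. Then the counit agrees on `D` with an element of `K`, and `D^⊥ ≤ K` forces `1 ∈ K`.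
-/
theorem IsSubcoalgebra.coannihilator_ne_bot {D : Submodule k C} [FiniteDimensional k D]
    (hD : IsSubcoalgebra k D) {K : Ideal (WithConv (C →ₗ[k] k))} (hK : hD.annihilator ≤ K)
    (htop : K ≠ ⊤) : K.coannihilator ≠ ⊥ := by
  intro hbot
  let W : Subspace k (Module.Dual k D) :=
    { carrier := {φ | ∃ f ∈ K, φ = f.ofConv ∘ₗ D.subtype}
      add_mem' := by
        rintro _ _ ⟨f, hf, rfl⟩ ⟨g, hg, rfl⟩
        exact ⟨f + g, add_mem hf hg, rfl⟩
      zero_mem' := ⟨0, zero_mem _, rfl⟩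
      smul_mem' := by
        rintro c _ ⟨f, hf, rfl⟩
        refine ⟨c • f, ?_, rfl⟩
        rw [← smul_one_mul]
        exact K.mul_mem_left _ hf }
  have hW : W.dualCoannihilator = ⊥ := by
    rw [eq_bot_iff]
    intro y hy
    rw [Submodule.mem_dualCoannihilator] at hy
    have : (y : C) ∈ K.coannihilator := fun f hf => hy _ ⟨f, hf, rfl⟩
    rw [hbot, Submodule.mem_bot] at this
    simpa using this
  have hWtop : W = ⊤ := by
    rw [← Subspace.dualCoannihilator_dualAnnihilator_eq (W := W), hW,
      Submodule.dualAnnihilator_bot]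
  have h1 : (1 : WithConv (C →ₗ[k] k)).ofConv ∘ₗ D.subtype ∈ W := hWtop ▸ Submodule.mem_top
  obtain ⟨f, hf, hf1⟩ := h1
  refine htop ((Ideal.eq_top_iff_one K).mpr ?_)
  have : (1 : WithConv (C →ₗ[k] k)) = f + (1 - f) := by abel
  rw [this]
  refine add_mem hf (hK fun x hx => ?_)
  change (1 : WithConv (C →ₗ[k] k)) x - f x = 0
  exact sub_eq_zero.mpr (LinearMap.congr_fun hf1 ⟨x, hx⟩)

theorem IsSubcoalgebra.exists_isSimpleSubcoalgebra_le {D : Submodule k C} [FiniteDimensional k D]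
    (hD : IsSubcoalgebra k D) (hne : D ≠ ⊥) :
    ∃ E : Submodule k C, IsSimpleSubcoalgebra k E ∧ E ≤ D := by
  let P : Set ℕ := {n | ∃ E : Submodule k C, IsSubcoalgebra k E ∧ E ≠ ⊥ ∧ E ≤ D ∧
    Module.finrank k E = n}
  have hP : P.Nonempty := ⟨_, D, hD, hne, le_rfl, rfl⟩
  obtain ⟨E, hE, hE0, hED, hEn⟩ := WellFounded.min_mem Nat.lt_wfRel.wf P hP
  refine ⟨E, ⟨hE, hE0, fun F hF hFE => or_iff_not_imp_left.mpr fun hF0 => ?_⟩, hED⟩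
  have : FiniteDimensional k E := Submodule.finiteDimensional_of_le hED
  refine Submodule.eq_of_le_of_finrank_le hFE ?_
  rw [hEn]
  exact not_lt.mp (WellFounded.not_lt_min Nat.lt_wfRel.wf P
    (show _ ∈ P from ⟨F, hF, hF0, hFE.trans hED, rfl⟩))

/-- A subcoalgebra containing the coradical which is closed under the wedge product is the whole
coalgebra. -/
theorem IsSubcoalgebra.eq_top_of_coradical_le {B : Submodule k C} (hB : IsSubcoalgebra k B)
    (hcor : coradical k C ≤ B)
    (hwedge : ∀ x : C, comul (R := k) x ∈ range (B.subtype.rTensor C) ⊔ range (B.subtype.lTensor C) →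
      x ∈ B) : B = ⊤ := by
  rw [eq_top_iff]
  rintro x -
  obtain ⟨D, hD, hfin, hxD⟩ := exists_finiteDimensional_isSubcoalgebra (k := k) x
  have := hD.isArtinianRing_quotient_annihilator
  rcases exists_pow_le_or_exists_sup_eq_top hD.annihilator hB.annihilator with
    ⟨n, hn⟩ | ⟨K, hK, hNK, htop, hsup⟩
  -- The zeros of the `n`-th power form the `n`-fold wedge of `B`; each factor is peeled off by
  -- `hwedge`.
  · have hpow : ∀ n, ∀ y : C, (∀ f ∈ hB.annihilator ^ n, f y = 0) → y ∈ B := by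
      intro n
      induction n with
      | zero =>
        intro y hy
        have : y = 0 := Module.eq_of_forall_withConv_dual (k := k) fun f => by
          rw [hy f (by simp [Submodule.pow_zero, Ideal.one_eq_top]), map_zero]
        rw [this]; exact B.zero_mem
      | succ n ih =>
        intro y hy
        refine hwedge y (TensorProduct.mem_range_rTensor_sup_range_lTensor fun f g hf hg => ?_)
        have hgB : hitLeft (toConv g) y ∈ B := ih _ fun φ hφ => by
          rw [apply_hitLeft]
          refine hy _ ?_
          rw [Submodule.pow_succ]
          exact Ideal.mul_mem_mul hφ fun z hz => hg z hz
        exact (apply_hitLeft (toConv f) (toConv g) y).symm.trans (hf _ hgB)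
    exact hpow n x fun f hf => hn hf x hxD
  · exfalso
    have hle := hD.coannihilator_le hNK
    have : FiniteDimensional k K.coannihilator := Submodule.finiteDimensional_of_le hle
    obtain ⟨E, hE, hEK⟩ := K.isSubcoalgebra_coannihilator.exists_isSimpleSubcoalgebra_le
      (hD.coannihilator_ne_bot hNK htop)
    have hEB : E ≤ B := (le_sSup hE).trans hcor
    refine hE.ne_bot (eq_bot_iff.mpr fun y hy => ?_)
    refine (Submodule.mem_bot k).mpr (Module.eq_of_forall_withConv_dual (k := k) fun f => ?_)
    have hf : f ∈ hB.annihilator ⊔ K := hsup ▸ Submodule.mem_top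
    obtain ⟨g, hg, h, hh, rfl⟩ := Submodule.mem_sup.mp hf
    rw [map_zero]
    change g y + h y = 0
    rw [hg y (hEB hy), hEK hy h hh, add_zero]

end DualAction

/-! ### The antipode, its image and wedges -/

/-- Both sides are convolution inverses of `Δ` among maps `A → A ⊗ A`: the left side on the right,
the right side on the left. -/
theorem HopfAlgebra.comul_comp_antipode (R A : Type*) [CommSemiring R] [Semiring A]
    [HopfAlgebra R A] :
    comul ∘ₗ HopfAlgebra.antipode R (A := A) =
      TensorProduct.map (HopfAlgebra.antipode R) (HopfAlgebra.antipode R) ∘ₗ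
        (TensorProduct.comm R A A).toLinearMap ∘ₗ comul := by
  set S := HopfAlgebra.antipode R (A := A) with hS
  set G : A →ₗ[R] A ⊗[R] A := TensorProduct.map S S ∘ₗ (TensorProduct.comm R A A).toLinearMap ∘ₗ
    comul with hG
  suffices h : toConv G * toConv (comul : A →ₗ[R] A ⊗[R] A) = 1 from
    toConv_injective (left_inv_eq_right_inv h comul_right_inv).symm
  -- `T (a ⊗ ((b ⊗ c) ⊗ d)) = S b * c ⊗ S a * d`
  let Q : (A ⊗[R] A) ⊗[R] (A ⊗[R] A) →ₗ[R] A ⊗[R] A :=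
    TensorProduct.map (mul' R A ∘ₗ S.rTensor A) (mul' R A ∘ₗ S.rTensor A)
  let E : A ⊗[R] ((A ⊗[R] A) ⊗[R] A) →ₗ[R] (A ⊗[R] A) ⊗[R] (A ⊗[R] A) :=
    (TensorProduct.leftComm R A (A ⊗[R] A) A).toLinearMap
  let T := Q ∘ₗ E
  have hT : mul' R (A ⊗[R] A) ∘ₗ TensorProduct.map
      (TensorProduct.map S S ∘ₗ (TensorProduct.comm R A A).toLinearMap) .id =
      T ∘ₗ (TensorProduct.assoc R A A A).symm.toLinearMap.lTensor A ∘ₗ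
        (TensorProduct.assoc R A A (A ⊗[R] A)).toLinearMap := by
    ext a b c d
    simp [T, Q, E]
  have hco : (TensorProduct.assoc R A A A).symm.toLinearMap.lTensor A ∘ₗ
        (TensorProduct.assoc R A A (A ⊗[R] A)).toLinearMap ∘ₗ
        TensorProduct.map comul comul ∘ₗ comul =
      (comul.rTensor A ∘ₗ comul).lTensor A ∘ₗ (comul : A →ₗ[R] A ⊗[R] A) := by
    simp only [coassoc_simps]
  have hTc : T ∘ₗ (comul.rTensor A).lTensor A =
      TensorProduct.map (Algebra.linearMap R A) (mul' R A ∘ₗ S.rTensor A) ∘ₗ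
        (TensorProduct.leftComm R A R A).toLinearMap ∘ₗ (counit.rTensor A).lTensor A := by
    ext a b d
    simp [T, Q, E, hS]
  ext x
  have e1 : (toConv G * toConv (comul : A →ₗ[R] A ⊗[R] A)) x =
      T ((comul.rTensor A).lTensor A ((comul (R := R) (A := A)).lTensor A (comul x))) := by
    have h1 := LinearMap.congr_fun hT (TensorProduct.map comul comul (comul x))
    have h2 := LinearMap.congr_fun hco x
    simp only [LinearMap.comp_apply, LinearMap.lTensor_comp] at h1 h2
    rw [h2] at h1
    rw [convMul_apply, ← h1]
    congr 1
    rw [← LinearMap.comp_apply (TensorProduct.map _ .id), ← TensorProduct.map_comp]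
    rfl
  rw [e1]
  have e2 := LinearMap.congr_fun hTc ((comul (R := R) (A := A)).lTensor A (comul x))
  rw [LinearMap.comp_apply] at e2
  rw [e2]
  have e3 : (counit.rTensor A).lTensor A ((comul (R := R) (A := A)).lTensor A (comul x)) =
      (TensorProduct.mk R R A 1).lTensor A (comul x) := by
    rw [← LinearMap.comp_apply, ← LinearMap.lTensor_comp, Coalgebra.rTensor_counit_comp_comul]
  rw [LinearMap.comp_apply, LinearMap.comp_apply, e3]
  have e4 : (TensorProduct.map (Algebra.linearMap R A) (mul' R A ∘ₗ S.rTensor A) ∘ₗ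
        (TensorProduct.leftComm R A R A).toLinearMap ∘ₗ (TensorProduct.mk R R A 1).lTensor A) =
      TensorProduct.mk R A A 1 ∘ₗ mul' R A ∘ₗ S.rTensor A := by
    ext a b; simp
  have e5 := LinearMap.congr_fun e4 (comul x)
  simp only [LinearMap.comp_apply] at e5
  rw [LinearEquiv.coe_coe] at e5 ⊢
  rw [e5]
  simp [hS, Algebra.algebraMap_eq_smul_one, Algebra.TensorProduct.one_def]

theorem HopfAlgebra.isSubcoalgebra_range_antipode (k H : Type*) [Field k] [Ring H]
    [HopfAlgebra k H] : IsSubcoalgebra k (range (HopfAlgebra.antipode k (A := H))) := by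
  rintro _ ⟨x, rfl⟩
  rw [TensorProduct.range_mapIncl]
  rw [← LinearMap.comp_apply, HopfAlgebra.comul_comp_antipode]
  have := LinearMap.mem_range_self
    (TensorProduct.map (HopfAlgebra.antipode k (A := H)) (HopfAlgebra.antipode k (A := H)))
    (TensorProduct.comm k H H (comul x))
  rw [TensorProduct.range_map] at this
  simpa using this

/-- A subcoalgebra which is closed under multiplication and contains the image of the antipode
is closed under the wedge product: it contains every `x` with `Δ x ∈ B ⊗ H + H ⊗ B`. -/
theorem HopfAlgebra.mem_of_comul_mem_sup {k H : Type*} [Field k] [Ring H] [HopfAlgebra k H]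
    {B : Submodule k H} (hB : IsSubcoalgebra k B) (hmul : ∀ a ∈ B, ∀ b ∈ B, a * b ∈ B)
    (hS : range (HopfAlgebra.antipode k (A := H)) ≤ B) {x : H}
    (hx : comul (R := k) x ∈ range (B.subtype.rTensor H) ⊔ range (B.subtype.lTensor H)) :
    x ∈ B := by
  obtain ⟨r, hr⟩ := B.subtype.exists_leftInverse_of_injective B.ker_subtype
  set S := HopfAlgebra.antipode k (A := H) with hSdef
  let p : H →ₗ[k] H := B.subtype ∘ₗ r
  have hpB : ∀ h, p h ∈ B := fun h => (r h).2
  have hp : ∀ b : B, p b = b := fun b => congrArg Subtype.val (LinearMap.congr_fun hr b)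
  -- `F` sends `h ⊗ y ⊗ z` to the class of `h S(y) p(z)`. The projection `p` makes it vanish
  -- whenever `h ∈ B`, while leaving `z ∈ B` unchanged.
  let F : H ⊗[k] (H ⊗[k] H) →ₗ[k] H ⧸ B :=
    B.mkQ ∘ₗ mul' k H ∘ₗ (mul' k H ∘ₗ TensorProduct.map S p).lTensor H
  have hF : ∀ b ∈ B, ∀ t, F (b ⊗ₜ t) = 0 := by
    intro b hb t
    induction t with
    | zero => simp
    | add t₁ t₂ h₁ h₂ => rw [TensorProduct.tmul_add, map_add, h₁, h₂, add_zero]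
    | tmul y z =>
      simpa [F] using hmul _ hb _ (hmul _ (hS (LinearMap.mem_range_self S y)) _ (hpB z))
  -- On `H ⊗ B`, `S(z₁) p(z₂) = S(z₁) z₂ = ε(z)`; on `B ⊗ H` both sides vanish.
  have h₁ : F ((comul (R := k) (A := H)).lTensor H (comul x)) = B.mkQ x := by
    have hle : range (B.subtype.rTensor H) ⊔ range (B.subtype.lTensor H) ≤
        eqLocus (F ∘ₗ (comul (R := k) (A := H)).lTensor H)
          (B.mkQ ∘ₗ (TensorProduct.rid k H).toLinearMap ∘ₗ counit.lTensor H) := by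
      refine sup_le ?_ ?_ <;> rw [LinearMap.range_le_iff_comap, eq_top_iff] <;> rintro t - <;>
        rw [Submodule.mem_comap] <;> induction t with
        | zero => simp
        | add t₁ t₂ h₁ h₂ => rw [map_add]; exact add_mem h₁ h₂
        | tmul y z => ?_
      · simp [hF _ y.2, (Submodule.Quotient.mk_eq_zero B).mpr y.2]
      · obtain ⟨t, ht⟩ := hB z z.2
        have key : (mul' k H ∘ₗ TensorProduct.map S p) (comul (z : H)) =
            mul' k H (S.rTensor H (comul (z : H))) := by
          rw [← ht, ← LinearMap.comp_apply, ← LinearMap.comp_apply, ← LinearMap.comp_apply]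
          congr 1
          ext a b
          simp [hp]
        rw [HopfAlgebra.mul_antipode_rTensor_comul_apply] at key
        simp only [comp_apply] at key
        simp [F, key, Algebra.algebraMap_eq_smul_one]
    have := hle hx
    simpa using this
  -- After coassociativity, `B ⊗ H` lands in `B ⊗ B ⊗ H`, and `H ⊗ B` yields `y₁ S(y₂) z = ε(y) z ∈
  -- B`.
  have h₂ : F ((comul (R := k) (A := H)).lTensor H (comul x)) = 0 := by
    rw [← Coalgebra.coassoc_apply]
    have hle : range (B.subtype.rTensor H) ⊔ range (B.subtype.lTensor H) ≤
        ker (F ∘ₗ (TensorProduct.assoc k H H H).toLinearMap ∘ₗ comul.rTensor H) := by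
      refine sup_le ?_ ?_ <;> rw [LinearMap.range_le_iff_comap, eq_top_iff] <;> rintro t - <;>
        rw [Submodule.mem_comap] <;> induction t with
        | zero => simp
        | add t₁ t₂ h₁ h₂ => rw [map_add]; exact add_mem h₁ h₂
        | tmul y z => ?_
      · obtain ⟨t, ht⟩ := hB y y.2
        simp only [rTensor_tmul, Submodule.subtype_apply, mem_ker, comp_apply, ← ht]
        clear ht
        induction t with
        | zero => simp
        | add t₁ t₂ h₁ h₂ => rw [map_add, TensorProduct.add_tmul, map_add, map_add, h₁, h₂, add_zero]
        | tmul a b => simpa using hF _ a.2 _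
      · have key : ∀ t : H ⊗[k] H, F (TensorProduct.assoc k H H H (t ⊗ₜ (z : H))) =
            B.mkQ (mul' k H (S.lTensor H t) * z) := by
          intro t
          induction t with
          | zero => simp
          | add t₁ t₂ h₁ h₂ =>
            rw [TensorProduct.add_tmul, map_add, map_add, h₁, h₂, map_add, map_add, add_mul,
              map_add]
          | tmul a b => simp [F, hp, mul_assoc]
        rw [mem_ker]
        change F (TensorProduct.assoc k H H H (comul (y : H) ⊗ₜ (z : H))) = 0
        rw [key, HopfAlgebra.mul_antipode_lTensor_comul_apply, Submodule.mkQ_apply,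
          Submodule.Quotient.mk_eq_zero, ← Algebra.smul_def]
        exact B.smul_mem _ z.2
    exact hle hx
  rw [h₁] at h₂
  simpa using h₂

theorem mainTheorem11 (k H : Type*) [Field k] [Ring H] [HopfAlgebra k H]
    (hS : coradical k H ≤ LinearMap.range (HopfAlgebra.antipode k (A := H))) :
    Function.Surjective (HopfAlgebra.antipode k (A := H)) := by
  have hB := HopfAlgebra.isSubcoalgebra_range_antipode k H
  refine LinearMap.range_eq_top.mp (hB.eq_top_of_coradical_le hS fun x hx => ?_)
  refine HopfAlgebra.mem_of_comul_mem_sup hB ?_ le_rfl hx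
  rintro _ ⟨a, rfl⟩ _ ⟨b, rfl⟩
  exact ⟨b * a, HopfAlgebra.antipode_mul_antidistrib b a⟩
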